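/- Let $N\ge 2$, $a\in(-1,+\infty)$, $p\in(\max\{1+a,1\},N+a)$, let $\mu=|x_N|^a\mathcal L^N$ on $\mathbb R^N$, and put $p^*=\frac{(N+a)p}{N+a-p}$. Let $K^p(\mathbb R^N,\mu)$ be the space of all $u\in L^{p^*}(\mathbb R^N,\mu)$ with weak gradient $\nabla u\in L^p(\mathbb R^N,\mu)^N$, and let $W^{1,p}_0(\mathbb R^N,\mu)$ be the closure of $C_0^\infty(\mathbb R^N)$ in the norm $\|u\|_{L^p(\mu)}+\|\nabla u\|_{L^p(\mu)}$. For $E\subseteq\mathbb R^N$ set $$\mathrm{cap}_{p,\mu}(E)=\inf_{A'\text{ open},\,A'\supseteq E}\ \inf\Big\{\int_{\mathbb R^N}|\nabla u|^p\,d\mu:\ u\in W_0^{1,p}(\mathbb R^N,\mu),\ u\ge 1\ \mathcal L^N\text{-a.e. on }A'\Big\}$$ (with $\inf\emptyset=+\infty$). A property holds q.e. if it holds outside a set of capacity zero. The precise representative $\tilde u$ of $u$ is its quasicontinuous representative: $\tilde u=u$ a.e., and for every $\varepsilon>0$ there is an open set $G$ with $\mathrm{cap}_{p,\mu}(G)<\varepsilon$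 such that $\tilde u$ restricted to $\mathbb R^N\setminus G$ is continuous; $\tilde u$ is determined up to a set of capacity zero. A global $(p,\mu)$-capacitary potential $u^E$ of $E$ is a minimizer of $\int_{\mathbb R^N}|\nabla u|^p\,d\mu$ among all $u\in K^p(\mathbb R^N,\mu)$ with $\tilde u\ge 1$ q.e. on $E$. If $E\subseteq F\subseteq\mathbb R^N$ have global $(p,\mu)$-capacitary potentials $u^E$ and $u^F$, then $u^E\le u^F$ $\mathcal L^N$-a.e. in $\mathbb R^N$. -/

import Mathlib

open MeasureTheory Filter Topology
open scoped ENNReal ContDiff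

namespace CapPot

/-- Points of `ℝ^N` with `N = d + 1`, with the Euclidean norm.  The last coordinate is `x_N`. -/
abbrev Pt (d : ℕ) : Type := EuclideanSpace ℝ (Fin (d + 1))

/-- The weighted measure `μ = |x_N|^a 𝓛^N` on `ℝ^N`. -/
noncomputable def wMeasure (d : ℕ) (a : ℝ) : Measure (Pt d) :=
  volume.withDensity fun x => ENNReal.ofReal (|x (Fin.last d)| ^ a)

/-- The Sobolev exponent `p* = (N + a) p / (N + a - p)`, where `N = d + 1`. -/
noncomputable def sobolevExp (d : ℕ) (a p : ℝ) : ℝ :=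
  (((d + 1 : ℕ) : ℝ) + a) * p / (((d + 1 : ℕ) : ℝ) + a - p)

/-- A smooth compactly supported function on `ℝ^N`. -/
def IsTest {d : ℕ} (φ : Pt d → ℝ) : Prop :=
  ContDiff ℝ ∞ φ ∧ HasCompactSupport φ

/-- `G` is the weak (distributional) gradient of `u` on `ℝ^N`. -/
def HasWeakGrad {d : ℕ} (u : Pt d → ℝ) (G : Pt d → Pt d) : Prop :=
  LocallyIntegrable u volume ∧ LocallyIntegrable G volume ∧
    ∀ φ : Pt d → ℝ, IsTest φ → ∀ i : Fin (d + 1),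
      ∫ x, u x * fderiv ℝ φ x (EuclideanSpace.single i 1) = -∫ x, G x i * φ x

/-- The energy `∫ |∇u|^p dμ`.  The weak gradient is unique up to null sets, so the infimum ranges
over a single value; it is `+∞` if `u` has no weak gradient. -/
noncomputable def energy {d : ℕ} (a p : ℝ) (u : Pt d → ℝ) : ℝ≥0∞ :=
  ⨅ (G : Pt d → Pt d) (_ : HasWeakGrad u G),
    ∫⁻ x, ENNReal.ofReal (‖G x‖ ^ p) ∂(wMeasure d a)

/-- `u ∈ W₀^{1,p}(ℝ^N, μ)`, the closure of `C₀^∞(ℝ^N)` in the norm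
`‖u‖_{L^p(μ)} + ‖∇u‖_{L^p(μ)}`. -/
def MemW0 {d : ℕ} (a p : ℝ) (u : Pt d → ℝ) : Prop :=
  MemLp u (ENNReal.ofReal p) (wMeasure d a) ∧
  ∃ G : Pt d → Pt d, HasWeakGrad u G ∧ MemLp G (ENNReal.ofReal p) (wMeasure d a) ∧
    ∃ φ : ℕ → Pt d → ℝ, (∀ n, IsTest (φ n)) ∧
      Tendsto (fun n => eLpNorm (fun x => φ n x - u x) (ENNReal.ofReal p) (wMeasure d a))
        atTop (𝓝 0) ∧
      Tendsto
        (fun n => eLpNorm (fun x => gradient (φ n) x - G x) (ENNReal.ofReal p) (wMeasure d a))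
        atTop (𝓝 0)

/-- `u ∈ K^p(ℝ^N, μ)`: `u ∈ L^{p*}(μ)` and `∇u ∈ L^p(μ)^N`. -/
def MemK {d : ℕ} (a p : ℝ) (u : Pt d → ℝ) : Prop :=
  MemLp u (ENNReal.ofReal (sobolevExp d a p)) (wMeasure d a) ∧
  ∃ G : Pt d → Pt d, HasWeakGrad u G ∧ MemLp G (ENNReal.ofReal p) (wMeasure d a)

/-- The variational `(p,μ)`-capacity of `E` relative to `ℝ^N`; the infimum of the empty set
is `+∞`. -/
noncomputable def capacity {d : ℕ} (a p : ℝ) (E : Set (Pt d)) : ℝ≥0∞ :=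
  ⨅ (A : Set (Pt d)) (_ : IsOpen A ∧ E ⊆ A),
    ⨅ (u : Pt d → ℝ) (_ : MemW0 a p u ∧ ∀ᵐ x ∂(volume : Measure (Pt d)), x ∈ A → 1 ≤ u x),
      energy a p u

/-- `v` is quasicontinuous: it is continuous off open sets of arbitrarily small capacity. -/
def QuasiContinuous {d : ℕ} (a p : ℝ) (v : Pt d → ℝ) : Prop :=
  ∀ ε : ℝ≥0∞, 0 < ε → ∃ G : Set (Pt d), IsOpen G ∧ capacity a p G < ε ∧ ContinuousOn v Gᶜ

/-- `v` is a precise (that is, quasicontinuous) representative of `u`.  Any two such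
representatives agree outside a set of capacity zero. -/
def IsPreciseRep {d : ℕ} (a p : ℝ) (u v : Pt d → ℝ) : Prop :=
  v =ᵐ[(volume : Measure (Pt d))] u ∧ QuasiContinuous a p v

/-- The admissible functions in the (relaxed) capacitary problem of `E` in `ℝ^N`:
`u ∈ K^p(ℝ^N, μ)` whose precise representative is `≥ 1` on `E`, up to a set of capacity zero. -/
def Admissible {d : ℕ} (a p : ℝ) (E : Set (Pt d)) (u : Pt d → ℝ) : Prop :=
  MemK a p u ∧
    ∃ v : Pt d → ℝ, IsPreciseRep a p u v ∧ capacity a p {x | x ∈ E ∧ ¬ 1 ≤ v x} = 0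

/-- `u` is the global `(p,μ)`-capacitary potential `u^E` of `E`: it minimizes `∫ |∇u|^p dμ` among
all admissible functions. -/
def IsCapacitaryPotential {d : ℕ} (a p : ℝ) (E : Set (Pt d)) (u : Pt d → ℝ) : Prop :=
  Admissible a p E u ∧ ∀ w : Pt d → ℝ, Admissible a p E w → energy a p u ≤ energy a p w

end CapPot

/-! Let T = `softPos`, a C¹ substitute for the positive part: T = 0 on (-∞, 0], while 0 < T(t) ≤ t
and 0 < T'(t) < 1 for t > 0. Put w = T(u^E - u^F) and compare u^E with u^E - w, and u^F with u^F +
w. The first competitor stays above min(u^E, u^F), whose precise representative is ≥ 1 q.e. on E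
because E ⊆ F; the second only increases u^F. Both are therefore admissible.

With θ = T'(u^E - u^F), the new gradients are ∇u^E - θ(∇u^E - ∇u^F) and ∇u^F + θ(∇u^E - ∇u^F):
convex combinations of the old ones with exchanged weights. Convexity of |·|^p bounds the sum of the
new energy densities by the sum of the old, and minimality gives the reverse inequality for the
integrals. Strict convexity then forces ∇w = θ(∇u^E - ∇u^F) = 0
(`ae_smul_sub_eq_zero_of_energy_le`). Hence w is constant (`HasWeakGrad.ae_const`), and zero because
w ∈ L^{p*}(μ) and μ has infinite mass (`wMeasure_univ`); T > 0 on (0, ∞) gives u^E ≤ u^F.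

Since T is C¹, a chain rule proved by mollification (`HasWeakGrad.comp`) suffices. Admissibility
also needs that quasicontinuity survives continuous combinations and that two sets of capacity zero
have a union of capacity zero; both follow from `capacity_union_le`. -/

namespace CapPot

open scoped Convolution

/-! ### Mollification and L¹ convergence -/

/-- The standard mollifier of radius `1 / (n + 1)`. -/
noncomputable def bump (d n : ℕ) : ContDiffBump (0 : Pt d) where
  rIn := 1 / ((n : ℝ) + 1) / 2
  rOut := 1 / ((n : ℝ) + 1)
  rIn_pos := by positivity
  rIn_lt_rOut := half_lt_self (by positivity)

/-- The normalized kernel of the standard mollifier. -/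
noncomputable def ker (d n : ℕ) : Pt d → ℝ := (bump d n).normed volume

/-- Regularization by the standard mollifier. -/
noncomputable def mollify {d : ℕ} (n : ℕ) (u : Pt d → ℝ) : Pt d → ℝ :=
  ker d n ⋆[ContinuousLinearMap.lsmul ℝ ℝ, volume] u

lemma mollify_apply {d : ℕ} (n : ℕ) (u : Pt d → ℝ) (x : Pt d) :
    mollify n u x = ∫ t, ker d n t * u (x - t) := rfl

lemma ker_isTest (d n : ℕ) : IsTest (ker d n) :=
  ⟨(bump d n).contDiff_normed, (bump d n).hasCompactSupport_normed⟩

lemma ker_eq_zero {d n : ℕ} {x : Pt d} (hx : 1 < ‖x‖) : ker d n x = 0 := by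
  have h : x ∉ Function.support (ker d n) := by
    rw [ker, ContDiffBump.support_normed_eq, mem_ball_zero_iff, not_lt]
    refine le_trans ?_ hx.le
    change 1 / ((n : ℝ) + 1) ≤ 1
    rw [div_le_one (by positivity)]
    linarith [(Nat.cast_nonneg n : (0 : ℝ) ≤ n)]
  simpa using h

lemma mollify_tendsto_ae {d : ℕ} {u : Pt d → ℝ} (hu : LocallyIntegrable u volume) :
    ∀ᵐ x, Tendsto (fun n => mollify n u x) atTop (𝓝 (u x)) := by
  refine ContDiffBump.ae_convolution_tendsto_right_of_locallyIntegrable (φ := bump d) (K := 2)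
    ?_ (Eventually.of_forall fun n => ?_) hu
  · exact tendsto_one_div_add_atTop_nhds_zero_nat
  · change 1 / ((n : ℝ) + 1) ≤ 2 * (1 / ((n : ℝ) + 1) / 2)
    linarith

lemma mollify_continuous {d : ℕ} {u : Pt d → ℝ} (hu : LocallyIntegrable u volume) (n : ℕ) :
    Continuous (mollify n u) :=
  (ker_isTest d n).2.continuous_convolution_left _ (ker_isTest d n).1.continuous hu

lemma ker_mul_integrable {d : ℕ} {u : Pt d → ℝ} (hu : LocallyIntegrable u volume) (n : ℕ)
    (x : Pt d) : Integrable (fun t => ker d n t * u (x - t)) :=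
  (ker_isTest d n).2.convolutionExists_left (ContinuousLinearMap.lsmul ℝ ℝ)
    (ker_isTest d n).1.continuous hu x

lemma mollify_integrable {d : ℕ} {u : Pt d → ℝ} (hu : Integrable u) (n : ℕ) :
    Integrable (mollify n u) :=
  ((ker_isTest d n).1.continuous.integrable_of_hasCompactSupport
    (ker_isTest d n).2).integrable_convolution _ hu

lemma integral_mollify {d : ℕ} {u : Pt d → ℝ} (hu : Integrable u) (n : ℕ) :
    ∫ x, mollify n u x = ∫ x, u x := by
  have h := integral_convolution (μ := volume) (ν := volume) (ContinuousLinearMap.lsmul ℝ ℝ)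
    ((ker_isTest d n).1.continuous.integrable_of_hasCompactSupport (ker_isTest d n).2) hu
  have h1 : ∫ x, ker d n x = 1 := (bump d n).integral_normed
  rw [h1] at h
  simpa [mollify] using h

/-- Scheffé's lemma for mollifications of nonnegative functions. -/
lemma mollify_tendsto_L1_of_nonneg {d : ℕ} {u : Pt d → ℝ} (hu : Integrable u) (h0 : ∀ x, 0 ≤ u x) :
    Tendsto (fun n => ∫ x, |mollify n u x - u x|) atTop (𝓝 0) := by
  have hm0 : ∀ n x, 0 ≤ mollify n u x := fun n x =>
    integral_nonneg fun t => mul_nonneg ((bump d n).nonneg_normed t) (h0 _)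
  have hdiff : ∀ n, Integrable fun x => u x - mollify n u x :=
    fun n => hu.sub (mollify_integrable hu n)
  -- The positive part of u - u_n lies between 0 and u, so dominated convergence applies to it.
  have hpos : Tendsto (fun n => ∫ x, max (u x - mollify n u x) 0) atTop (𝓝 0) := by
    have h := tendsto_integral_of_dominated_convergence (μ := (volume : Measure (Pt d)))
      (F := fun n x => max (u x - mollify n u x) 0) (f := fun _ => (0 : ℝ)) u
      (fun n => (hdiff n).pos_part.aestronglyMeasurable) hu
      (fun n => Eventually.of_forall fun x => by
        rw [Real.norm_eq_abs, abs_of_nonneg (le_max_right _ _)]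
        exact max_le (by linarith [hm0 n x]) (h0 x)) ?_
    · simpa using h
    · filter_upwards [mollify_tendsto_ae hu.locallyIntegrable] with x hx
      have h := (tendsto_const_nhds (x := u x)).sub hx
      simpa using h.max (tendsto_const_nhds (x := (0 : ℝ)))
  -- |s| = 2s⁺ - s with s = u - u_n, and the last term integrates to zero since mollification
  -- preserves the integral.
  have heq : ∀ n, ∫ x, |mollify n u x - u x| = 2 * ∫ x, max (u x - mollify n u x) 0 := by
    intro n
    have h1 : ∀ x, |mollify n u x - u x|
        = 2 * max (u x - mollify n u x) 0 - (u x - mollify n u x) := by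
      intro x
      rcases le_total (u x) (mollify n u x) with h | h
      · rw [abs_of_nonneg (by linarith), max_eq_right (by linarith)]; ring
      · rw [abs_of_nonpos (by linarith), max_eq_left (by linarith)]; ring
    simp_rw [h1]
    rw [integral_sub ((hdiff n).pos_part.const_mul 2) (hdiff n),
      integral_sub hu (mollify_integrable hu n), integral_mollify hu, sub_self, sub_zero,
      integral_const_mul]
  simp_rw [heq]
  simpa using hpos.const_mul 2

lemma mollify_sub {d : ℕ} {u v : Pt d → ℝ} (hu : LocallyIntegrable u volume)
    (hv : LocallyIntegrable v volume) (n : ℕ) (x : Pt d) :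
    mollify n (fun x => u x - v x) x = mollify n u x - mollify n v x := by
  simp_rw [mollify_apply, mul_sub]
  exact integral_sub (ker_mul_integrable hu n x) (ker_mul_integrable hv n x)

lemma mollify_tendsto_L1 {d : ℕ} {u : Pt d → ℝ} (hu : Integrable u) :
    Tendsto (fun n => ∫ x, |mollify n u x - u x|) atTop (𝓝 0) := by
  have hp := hu.pos_part
  have hn := hu.neg_part
  have h := (mollify_tendsto_L1_of_nonneg hp fun x => le_max_right _ _).add
    (mollify_tendsto_L1_of_nonneg hn fun x => le_max_right _ _)
  rw [add_zero] at h
  refine squeeze_zero (fun n => integral_nonneg fun x => abs_nonneg _) (fun n => ?_) h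
  refine le_trans ?_ (integral_add ((mollify_integrable hp n).sub hp).abs
    ((mollify_integrable hn n).sub hn).abs).le
  refine integral_mono ((mollify_integrable hu n).sub hu).abs
    (((mollify_integrable hp n).sub hp).abs.add ((mollify_integrable hn n).sub hn).abs) fun x => ?_
  have hu' : u = fun x => max (u x) 0 - max (-u x) 0 := by
    funext x
    rcases le_total 0 (u x) with h | h
    · rw [max_eq_left h, max_eq_right (by linarith)]; ring
    · rw [max_eq_right h, max_eq_left (by linarith)]; ring
  have e := mollify_sub hp.locallyIntegrable hn.locallyIntegrable n x
  rw [← hu'] at e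
  have e' := congrFun hu' x
  simp only at e' ⊢
  rw [e]
  conv_lhs => rw [e']
  have := abs_sub (mollify n (fun x => max (u x) 0) x - max (u x) 0)
    (mollify n (fun x => max (-u x) 0) x - max (-u x) 0)
  refine le_trans (le_of_eq ?_) this
  congr 1; ring

/-- Mollifications converge locally in `L¹`. -/
lemma mollify_tendsto_L1_mul {d : ℕ} {u φ : Pt d → ℝ} (hu : LocallyIntegrable u volume)
    (hφ : Continuous φ) (hc : HasCompactSupport φ) :
    Tendsto (fun n => ∫ x, |φ x| * |mollify n u x - u x|) atTop (𝓝 0) := by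
  obtain ⟨R, hR⟩ := hc.isCompact.isBounded.subset_closedBall (0 : Pt d)
  obtain ⟨C, hC⟩ := hφ.bounded_above_of_compact_support hc
  have hC0 : 0 ≤ C := (norm_nonneg _).trans (hC 0)
  -- The kernel lives in the unit ball, so cutting u off outside radius R + 1 changes no
  -- mollification on the support of φ.
  set v : Pt d → ℝ := (Metric.closedBall (0 : Pt d) (R + 1)).indicator u with hv
  have hvi : Integrable v := (integrable_indicator_iff measurableSet_closedBall).2
    (hu.integrableOn_isCompact (isCompact_closedBall _ _))
  have h := (mollify_tendsto_L1 hvi).const_mul C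
  rw [mul_zero] at h
  refine squeeze_zero (fun n => integral_nonneg fun x => by positivity) (fun n => ?_) h
  rw [← integral_const_mul]
  refine integral_mono_of_nonneg (Eventually.of_forall fun x => by positivity)
    (((mollify_integrable hvi n).sub hvi).abs.const_mul C) (Eventually.of_forall fun x => ?_)
  by_cases hx : φ x = 0
  · simp only [hx, abs_zero, zero_mul]; positivity
  · have hxR : ‖x‖ ≤ R := by simpa using hR (subset_tsupport _ hx)
    have h1 : v x = u x := Set.indicator_of_mem (by simp; linarith) _
    have h2 : mollify n v x = mollify n u x := by
      rw [mollify_apply, mollify_apply]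
      congr 1
      funext t
      by_cases ht : ‖t‖ ≤ 1
      · congr 1
        refine Set.indicator_of_mem ?_ _
        rw [mem_closedBall_zero_iff]
        linarith [norm_sub_le x t]
      · rw [ker_eq_zero (not_le.1 ht), zero_mul, zero_mul]
    simp only [h1, h2]
    exact mul_le_mul_of_nonneg_right (hC x) (abs_nonneg _)

/-! ### Calculus of weak gradients -/

/-- The derivative of a mollification is the mollification of the weak gradient. -/
lemma HasWeakGrad.hasFDerivAt_mollify {d : ℕ} {u : Pt d → ℝ} {G : Pt d → Pt d}
    (hu : HasWeakGrad u G) (n : ℕ) (x : Pt d) :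
    DifferentiableAt ℝ (mollify n u) x ∧ ∀ i : Fin (d + 1),
      fderiv ℝ (mollify n u) x (EuclideanSpace.single i 1) = mollify n (fun y => G y i) x := by
  obtain ⟨hs, hc⟩ := ker_isTest d n
  have hs1 : ContDiff ℝ 1 (ker d n) := hs.of_le (by exact_mod_cast le_top)
  have hd := hc.hasFDerivAt_convolution_left (ContinuousLinearMap.lsmul ℝ ℝ) hs1 hu.1 x
  refine ⟨hd.differentiableAt, fun i => ?_⟩
  have h1 : fderiv ℝ (mollify n u) x = _ := hd.fderiv
  have hint : Integrable fun t => ((ContinuousLinearMap.lsmul ℝ ℝ).precompL (Pt d)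
      (fderiv ℝ (ker d n) t)) (u (x - t)) :=
    (hc.fderiv ℝ).convolutionExists_left _ (hs1.continuous_fderiv (by norm_num)) hu.1 x
  rw [h1, convolution, ContinuousLinearMap.integral_apply hint]
  -- The reflected and translated kernel is the test function that turns the definition of the weak
  -- gradient into the claim.
  have h2 : IsTest fun y => ker d n (x - y) := by
    refine ⟨hs.comp (contDiff_const.sub contDiff_id), ?_⟩
    exact hc.comp_homeomorph (Homeomorph.subLeft x)
  have h3 := hu.2.2 _ h2 i
  have h4 : ∀ y, fderiv ℝ (fun y => ker d n (x - y)) y (EuclideanSpace.single i 1)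
      = -fderiv ℝ (ker d n) (x - y) (EuclideanSpace.single i 1) := by
    intro y
    have h := ((hs1.differentiable (by norm_num)) (x - y)).hasFDerivAt.comp y
      ((hasFDerivAt_const x y).sub (hasFDerivAt_id y))
    have h' : fderiv ℝ (fun y => ker d n (x - y)) y = _ := h.fderiv
    rw [h']; simp
  simp_rw [h4, mul_neg] at h3
  rw [integral_neg, neg_inj] at h3
  rw [mollify_apply]
  have h5 := integral_sub_left_eq_self (fun t => ker d n t * G (x - t) i) volume x
  have h6 := integral_sub_left_eq_self
    (fun t => fderiv ℝ (ker d n) t (EuclideanSpace.single i 1) * u (x - t)) volume x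
  simp only [sub_sub_cancel] at h5 h6
  rw [← h5]
  have h7 : ∀ t, (((ContinuousLinearMap.lsmul ℝ ℝ).precompL (Pt d)
      (fderiv ℝ (ker d n) t)) (u (x - t))) (EuclideanSpace.single i 1)
      = fderiv ℝ (ker d n) t (EuclideanSpace.single i 1) * u (x - t) := by
    intro t; simp [ContinuousLinearMap.precompL_apply]
  simp_rw [h7]
  rw [← h6]
  calc _ = ∫ y, u y * fderiv ℝ (ker d n) (x - y) (EuclideanSpace.single i 1) := by
        simp_rw [mul_comm]
    _ = _ := by rw [h3]; simp_rw [mul_comm]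

lemma locallyIntegrable_apply {d : ℕ} {G : Pt d → Pt d} (hG : LocallyIntegrable G volume)
    (i : Fin (d + 1)) : LocallyIntegrable (fun x => G x i) volume :=
  hG.mono ((EuclideanSpace.proj (𝕜 := ℝ) i).continuous.comp_aestronglyMeasurable
    hG.aestronglyMeasurable) (Eventually.of_forall fun x => PiLp.norm_apply_le (G x) i)

/-- An integrand that is a product with a continuous compactly supported function. -/
lemma integrable_mul_of_compact {d : ℕ} {u φ : Pt d → ℝ} (hu : LocallyIntegrable u volume)
    (hφ : Continuous φ) (hc : HasCompactSupport φ) : Integrable fun x => u x * φ x :=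
  hu.integrable_smul_right_of_hasCompactSupport hφ hc

lemma IsTest.continuous_partial {d : ℕ} {φ : Pt d → ℝ} (hφ : IsTest φ) (v : Pt d) :
    Continuous fun x => fderiv ℝ φ x v :=
  (hφ.1.continuous_fderiv (by simp)).clm_apply continuous_const

lemma IsTest.hasCompactSupport_partial {d : ℕ} {φ : Pt d → ℝ} (hφ : IsTest φ) (v : Pt d) :
    HasCompactSupport fun x => fderiv ℝ φ x v :=
  hφ.2.fderiv_apply ℝ v

lemma abs_sub_le_of_deriv_bound {h h' : ℝ → ℝ} {L : ℝ} (hh : ∀ t, HasDerivAt h (h' t) t)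
    (hL : ∀ t, |h' t| ≤ L) (s t : ℝ) : |h s - h t| ≤ L * |s - t| :=
  Convex.norm_image_sub_le_of_norm_hasDerivWithin_le (s := Set.univ)
    (fun x _ => (hh x).hasDerivWithinAt) (fun x _ => hL x) convex_univ trivial trivial

lemma tendsto_integral_of_abs_sub_le {d : ℕ} {F : ℕ → Pt d → ℝ} {f : Pt d → ℝ} {b : ℕ → Pt d → ℝ}
    (hF : ∀ n, Integrable (F n)) (hf : Integrable f) (hb : ∀ n, Integrable (b n))
    (h : ∀ n x, |F n x - f x| ≤ b n x) (hlim : Tendsto (fun n => ∫ x, b n x) atTop (𝓝 0)) :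
    Tendsto (fun n => ∫ x, F n x) atTop (𝓝 (∫ x, f x)) := by
  rw [tendsto_iff_norm_sub_tendsto_zero]
  refine squeeze_zero (fun n => norm_nonneg _) (fun n => ?_) hlim
  rw [← integral_sub (hF n) hf]
  exact (norm_integral_le_integral_norm _).trans
    (integral_mono ((hF n).sub hf).norm (hb n) fun x => h n x)

/-- Chain rule for weak gradients. -/
lemma HasWeakGrad.comp {d : ℕ} {u : Pt d → ℝ} {G : Pt d → Pt d} (hu : HasWeakGrad u G)
    {h h' : ℝ → ℝ} {L : ℝ} (hh : ∀ t, HasDerivAt h (h' t) t) (hc : Continuous h')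
    (hL : ∀ t, |h' t| ≤ L) :
    HasWeakGrad (fun x => h (u x)) (fun x => h' (u x) • G x) := by
  have hL0 : 0 ≤ L := (abs_nonneg _).trans (hL 0)
  have hlip := abs_sub_le_of_deriv_bound hh hL
  have hcont : Continuous h := continuous_iff_continuousAt.2 fun t => (hh t).continuousAt
  have hum := hu.1.aestronglyMeasurable
  have hl1 : LocallyIntegrable (fun x => h (u x)) volume := by
    have hn : LocallyIntegrable (fun x => |u x|) volume :=
      hu.1.mono hum.norm (Eventually.of_forall fun x => (norm_norm (u x)).le)
    refine ((locallyIntegrable_const |h 0|).add (hn.smul L)).mono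
      (hcont.comp_aestronglyMeasurable hum) (Eventually.of_forall fun x => ?_)
    have := hlip (u x) 0
    rw [sub_zero] at this
    simp only [Pi.add_apply, Pi.smul_apply, smul_eq_mul, Real.norm_eq_abs]
    rw [abs_of_nonneg (a := |h 0| + L * |u x|) (by positivity)]
    linarith [abs_sub_abs_le_abs_sub (h (u x)) (h 0)]
  have hl2 : LocallyIntegrable (fun x => h' (u x) • G x) volume := by
    refine (hu.2.1.smul L).mono ((hc.comp_aestronglyMeasurable hum).smul
      hu.2.1.aestronglyMeasurable) (Eventually.of_forall fun x => ?_)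
    rw [Pi.smul_apply, norm_smul, norm_smul]
    gcongr
    exact (hL _).trans (le_abs_self L)
  refine ⟨hl1, hl2, fun φ hφ i => ?_⟩
  have hGi := locallyIntegrable_apply hu.2.1 i
  have hhGi := locallyIntegrable_apply hl2 i
  have cu := mollify_continuous hu.1
  have cg := mollify_continuous hGi
  have cφ := hφ.1.continuous
  have cd := hφ.continuous_partial (EuclideanSpace.single i 1)
  have sd := hφ.hasCompactSupport_partial (EuclideanSpace.single i 1)
  have hder : ∀ n x, HasFDerivAt (fun x => h (mollify n u x))
      (h' (mollify n u x) • fderiv ℝ (mollify n u) x) x := fun n x =>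
    (hh _).comp_hasFDerivAt x (hu.hasFDerivAt_mollify n x).1.hasFDerivAt
  have hder' : ∀ n x, fderiv ℝ (fun x => h (mollify n u x)) x (EuclideanSpace.single i 1)
      = h' (mollify n u x) * mollify n (fun y => G y i) x := by
    intro n x
    rw [(hder n x).fderiv, _root_.smul_apply, smul_eq_mul,
      (hu.hasFDerivAt_mollify n x).2 i]
  have i1 : ∀ n, Integrable fun x =>
      h (mollify n u x) * fderiv ℝ φ x (EuclideanSpace.single i 1) := fun n =>
    integrable_mul_of_compact (hcont.comp (cu n)).locallyIntegrable cd sd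
  have i2 : ∀ n, Integrable fun x =>
      h' (mollify n u x) * mollify n (fun y => G y i) x * φ x := fun n =>
    integrable_mul_of_compact ((hc.comp (cu n)).mul (cg n)).locallyIntegrable cφ hφ.2
  -- Mollifications are differentiable, so the classical chain rule and integration by parts apply;
  -- it remains to pass to the limit.
  have heq : ∀ n, ∫ x, h (mollify n u x) * fderiv ℝ φ x (EuclideanSpace.single i 1)
      = -∫ x, h' (mollify n u x) * mollify n (fun y => G y i) x * φ x := by
    intro n
    rw [integral_mul_fderiv_eq_neg_fderiv_mul_of_integrable]
    · simp_rw [hder']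
    · simp_rw [hder']; exact i2 n
    · exact i1 n
    · exact integrable_mul_of_compact (hcont.comp (cu n)).locallyIntegrable cφ hφ.2
    · exact fun x _ => (hder n x).differentiableAt
    · exact fun x _ => (hφ.1.differentiable (by simp)) x
  have iabs : ∀ {v ψ : Pt d → ℝ}, LocallyIntegrable v volume → Continuous ψ →
      HasCompactSupport ψ → ∀ n, Integrable fun x => L * (|ψ x| * |mollify n v x - v x|) := by
    intro v ψ hv hψ hs n
    refine Integrable.const_mul ?_ L
    have := (integrable_mul_of_compact
      (((mollify_continuous hv n).locallyIntegrable (μ := volume)).sub hv) hψ hs).abs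
    simpa [abs_mul, mul_comm] using this
  have lim1 : Tendsto (fun n => ∫ x, h (mollify n u x) * fderiv ℝ φ x (EuclideanSpace.single i 1))
      atTop (𝓝 (∫ x, h (u x) * fderiv ℝ φ x (EuclideanSpace.single i 1))) := by
    refine tendsto_integral_of_abs_sub_le i1 (integrable_mul_of_compact hl1 cd sd)
      (iabs hu.1 cd sd) (fun n x => ?_) ?_
    · rw [← sub_mul, abs_mul]
      calc _ ≤ L * |mollify n u x - u x| * |fderiv ℝ φ x (EuclideanSpace.single i 1)| := by
            gcongr; exact hlip _ _
        _ = _ := by ring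
    · simp_rw [integral_const_mul]
      simpa using (mollify_tendsto_L1_mul hu.1 cd sd).const_mul L
  -- As h' is merely continuous and bounded, h'(u_n) G_n φ is split into h'(u_n) G φ, handled by
  -- dominated convergence, and h'(u_n)(G_n - G) φ, handled by local L¹ convergence.
  have im : ∀ n, Integrable fun x => h' (mollify n u x) * (G x i * φ x) := fun n => by
    have := integrable_mul_of_compact (u := fun x => G x i) hGi
      ((hc.comp (cu n)).mul cφ) (hφ.2.mul_left)
    refine this.congr (Eventually.of_forall fun x => ?_)
    simp only [Pi.mul_apply, Function.comp]; ring
  have lim2 : Tendsto (fun n => ∫ x, h' (mollify n u x) * (G x i * φ x)) atTop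
      (𝓝 (∫ x, h' (u x) * (G x i * φ x))) := by
    refine tendsto_integral_of_dominated_convergence (fun x => L * ‖G x i * φ x‖)
      (fun n => (im n).aestronglyMeasurable)
      ((integrable_mul_of_compact hGi cφ hφ.2).norm.const_mul L)
      (fun n => Eventually.of_forall fun x => ?_) ?_
    · rw [norm_mul]
      gcongr
      exact hL _
    · filter_upwards [mollify_tendsto_ae hu.1] with x hx
      exact ((hc.tendsto _).comp hx).mul_const _
  have lim3 : Tendsto (fun n => ∫ x, (h' (mollify n u x) * mollify n (fun y => G y i) x * φ x
      - h' (mollify n u x) * (G x i * φ x))) atTop (𝓝 (∫ _ : Pt d, (0 : ℝ))) := by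
    refine tendsto_integral_of_abs_sub_le (fun n => (i2 n).sub (im n)) (integrable_zero _ _ _)
      (iabs hGi cφ hφ.2) (fun n x => ?_) ?_
    · have : h' (mollify n u x) * mollify n (fun y => G y i) x * φ x
          - h' (mollify n u x) * (G x i * φ x) - 0
          = h' (mollify n u x) * (φ x * (mollify n (fun y => G y i) x - G x i)) := by ring
      rw [this, abs_mul, abs_mul]
      gcongr
      exact hL _
    · simp_rw [integral_const_mul]
      simpa using (mollify_tendsto_L1_mul hGi cφ hφ.2).const_mul L
  have lim4 := lim3.add lim2
  have e : ∀ n, (∫ x, (h' (mollify n u x) * mollify n (fun y => G y i) x * φ x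
      - h' (mollify n u x) * (G x i * φ x))) + ∫ x, h' (mollify n u x) * (G x i * φ x)
      = ∫ x, h' (mollify n u x) * mollify n (fun y => G y i) x * φ x := by
    intro n
    rw [integral_sub (i2 n) (im n)]; ring
  simp_rw [e] at lim4
  rw [integral_zero, zero_add] at lim4
  simp_rw [heq] at lim1
  rw [tendsto_nhds_unique lim1 lim4.neg]
  simp [mul_assoc]

lemma HasWeakGrad.add {d : ℕ} {u v : Pt d → ℝ} {G H : Pt d → Pt d} (hu : HasWeakGrad u G)
    (hv : HasWeakGrad v H) : HasWeakGrad (fun x => u x + v x) (fun x => G x + H x) := by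
  refine ⟨hu.1.add hv.1, hu.2.1.add hv.2.1, fun φ hφ i => ?_⟩
  have cd := hφ.continuous_partial (EuclideanSpace.single i 1)
  have sd := hφ.hasCompactSupport_partial (EuclideanSpace.single i 1)
  have cφ := hφ.1.continuous
  simp_rw [PiLp.add_apply, add_mul]
  rw [integral_add (integrable_mul_of_compact hu.1 cd sd) (integrable_mul_of_compact hv.1 cd sd),
    integral_add (integrable_mul_of_compact (locallyIntegrable_apply hu.2.1 i) cφ hφ.2)
      (integrable_mul_of_compact (locallyIntegrable_apply hv.2.1 i) cφ hφ.2),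
    hu.2.2 φ hφ i, hv.2.2 φ hφ i, neg_add]

lemma HasWeakGrad.neg {d : ℕ} {u : Pt d → ℝ} {G : Pt d → Pt d} (hu : HasWeakGrad u G) :
    HasWeakGrad (fun x => -u x) (fun x => -G x) := by
  refine ⟨hu.1.neg, hu.2.1.neg, fun φ hφ i => ?_⟩
  simp only [PiLp.neg_apply, neg_mul, integral_neg, hu.2.2 φ hφ i]

lemma HasWeakGrad.sub {d : ℕ} {u v : Pt d → ℝ} {G H : Pt d → Pt d} (hu : HasWeakGrad u G)
    (hv : HasWeakGrad v H) : HasWeakGrad (fun x => u x - v x) (fun x => G x - H x) := by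
  simpa only [sub_eq_add_neg] using hu.add hv.neg

lemma HasWeakGrad.congr_grad {d : ℕ} {u : Pt d → ℝ} {G H : Pt d → Pt d} (hu : HasWeakGrad u G)
    (h : G =ᵐ[volume] H) : HasWeakGrad u H := by
  refine ⟨hu.1, hu.2.1.congr h, fun φ hφ i => ?_⟩
  rw [hu.2.2 φ hφ i, integral_congr_ae]
  filter_upwards [h] with x hx
  rw [hx]

/-- Weak gradients are unique up to null sets. -/
lemma HasWeakGrad.ae_eq {d : ℕ} {u : Pt d → ℝ} {G H : Pt d → Pt d} (hG : HasWeakGrad u G)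
    (hH : HasWeakGrad u H) : G =ᵐ[volume] H := by
  have h : ∀ i : Fin (d + 1), ∀ᵐ x, G x i - H x i = 0 := by
    intro i
    have lG := locallyIntegrable_apply hG.2.1 i
    have lH := locallyIntegrable_apply hH.2.1 i
    refine ae_eq_zero_of_integral_contDiff_smul_eq_zero (f := fun x => G x i - H x i)
      (lG.sub lH) fun φ hφ hc => ?_
    have h1 := hG.2.2 φ ⟨hφ, hc⟩ i
    rw [hH.2.2 φ ⟨hφ, hc⟩ i, neg_inj] at h1
    simp_rw [smul_eq_mul, mul_comm (φ _), sub_mul]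
    rw [integral_sub (integrable_mul_of_compact lG hφ.continuous hc)
      (integrable_mul_of_compact lH hφ.continuous hc), h1, sub_self]
  filter_upwards [ae_all_iff.2 h] with x hx
  ext i
  exact sub_eq_zero.1 (hx i)

/-- A function with vanishing weak gradient is constant. -/
lemma HasWeakGrad.ae_const {d : ℕ} {u : Pt d → ℝ} (hu : HasWeakGrad u fun _ => 0) :
    ∃ c : ℝ, u =ᵐ[volume] fun _ => c := by
  -- Every mollification has zero derivative, hence is constant, and these constants converge to u
  -- almost everywhere.
  have hconst : ∀ n x, mollify n u x = mollify n u 0 := by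
    intro n x
    refine is_const_of_fderiv_eq_zero (𝕜 := ℝ) (fun x => (hu.hasFDerivAt_mollify n x).1)
      (fun x => ?_) x 0
    refine ContinuousLinearMap.coe_injective
      ((EuclideanSpace.basisFun (Fin (d + 1)) ℝ).toBasis.ext fun i => ?_)
    have := (hu.hasFDerivAt_mollify n x).2 i
    simpa [mollify_apply] using this
  have hae := mollify_tendsto_ae hu.1
  obtain ⟨x₀, hx₀⟩ := hae.exists
  refine ⟨u x₀, ?_⟩
  filter_upwards [hae] with x hx
  simp_rw [hconst _ x] at hx
  simp_rw [hconst _ x₀] at hx₀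
  exact tendsto_nhds_unique hx hx₀

/-! ### Energy and stability properties of W₀^{1,p} -/

lemma wMeasure_ac (d : ℕ) (a : ℝ) : wMeasure d a ≪ (volume : Measure (Pt d)) :=
  withDensity_absolutelyContinuous _ _

lemma HasWeakGrad.energy_eq {d : ℕ} {a p : ℝ} {u : Pt d → ℝ} {G : Pt d → Pt d}
    (hu : HasWeakGrad u G) :
    energy a p u = ∫⁻ x, ENNReal.ofReal (‖G x‖ ^ p) ∂(wMeasure d a) := by
  refine le_antisymm (iInf₂_le G hu) (le_iInf₂ fun H hH => le_of_eq (lintegral_congr_ae ?_))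
  filter_upwards [(wMeasure_ac d a).ae_le (hu.ae_eq hH)] with x hx
  rw [hx]

lemma tendsto_eLpNorm_zero_of_dominated {α E : Type*} [MeasurableSpace α] [NormedAddCommGroup E]
    {μ : Measure α} {q : ℝ≥0∞} (hq0 : q ≠ 0) (hq : q ≠ ⊤) {f : ℕ → α → E} {g : α → E}
    (hf : ∀ n, AEStronglyMeasurable (f n) μ) (hg : MemLp g q μ)
    (hfg : ∀ n x, ‖f n x‖ₑ ≤ ‖g x‖ₑ)
    (hlim : ∀ᵐ x ∂μ, Tendsto (fun n => f n x) atTop (𝓝 0)) :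
    Tendsto (fun n => eLpNorm (f n) q μ) atTop (𝓝 0) := by
  have hq' : 0 < q.toReal := ENNReal.toReal_pos hq0 hq
  simp_rw [eLpNorm_eq_lintegral_rpow_enorm_toReal hq0 hq]
  have h := tendsto_lintegral_of_dominated_convergence' (μ := μ)
    (F := fun n x => ‖f n x‖ₑ ^ q.toReal) (f := fun _ => 0) (fun x => ‖g x‖ₑ ^ q.toReal)
    (fun n => (hf n).enorm.pow_const _)
    (fun n => Eventually.of_forall fun x => ENNReal.rpow_le_rpow (hfg n x) hq'.le)
    (lintegral_rpow_enorm_lt_top_of_eLpNorm_lt_top hq0 hq hg.2).ne ?_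
  · rw [lintegral_zero] at h
    have h2 := (ENNReal.continuous_rpow_const (y := 1 / q.toReal)).tendsto 0 |>.comp h
    rw [ENNReal.zero_rpow_of_pos (by positivity)] at h2
    exact h2
  · filter_upwards [hlim] with x hx
    have h1 : Tendsto (fun n => ‖f n x‖ₑ) atTop (𝓝 0) := by simpa using hx.enorm
    have h2 := (ENNReal.continuous_rpow_const (y := q.toReal)).tendsto 0 |>.comp h1
    rw [ENNReal.zero_rpow_of_pos hq'] at h2
    exact h2

lemma gradient_comp {d : ℕ} {φ : Pt d → ℝ} {h h' : ℝ → ℝ} (hh : ∀ t, HasDerivAt h (h' t) t)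
    {x : Pt d} (hφ : DifferentiableAt ℝ φ x) :
    gradient (fun x => h (φ x)) x = h' (φ x) • gradient φ x := by
  have := ((hh (φ x)).comp_hasFDerivAt x hφ.hasFDerivAt).fderiv
  rw [gradient, gradient]
  change (InnerProductSpace.toDual ℝ (Pt d)).symm (fderiv ℝ (h ∘ φ) x) = _
  rw [this]
  simp

lemma gradient_add {d : ℕ} {φ ψ : Pt d → ℝ} {x : Pt d} (hφ : DifferentiableAt ℝ φ x)
    (hψ : DifferentiableAt ℝ ψ x) :
    gradient (fun x => φ x + ψ x) x = gradient φ x + gradient ψ x := by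
  have := (hφ.hasFDerivAt.add hψ.hasFDerivAt).fderiv
  rw [gradient, gradient, gradient]
  change (InnerProductSpace.toDual ℝ (Pt d)).symm (fderiv ℝ (φ + ψ) x) = _
  rw [this, map_add]

lemma IsTest.differentiable {d : ℕ} {φ : Pt d → ℝ} (hφ : IsTest φ) : Differentiable ℝ φ :=
  hφ.1.differentiable (by simp)

lemma IsTest.continuous_gradient {d : ℕ} {φ : Pt d → ℝ} (hφ : IsTest φ) :
    Continuous (gradient φ) :=
  (InnerProductSpace.toDual ℝ (Pt d)).symm.continuous.comp (hφ.1.continuous_fderiv (by simp))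

/-- `W₀^{1,p}` is stable under composition with smooth Lipschitz functions vanishing at `0`. -/
lemma MemW0.comp {d : ℕ} {a p : ℝ} (hp : 1 < p) {u : Pt d → ℝ} (hu : MemW0 a p u)
    {h h' : ℝ → ℝ} {L : ℝ} (hs : ContDiff ℝ ∞ h) (hh : ∀ t, HasDerivAt h (h' t) t)
    (hc : Continuous h') (hL : ∀ t, |h' t| ≤ L) (h0 : h 0 = 0) :
    MemW0 a p fun x => h (u x) := by
  obtain ⟨hu1, G, hG, hGp, φ, hφ, hφu, hφG⟩ := hu
  have hq0 : ENNReal.ofReal p ≠ 0 := by simpa using by linarith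
  have hq1 : 1 ≤ ENNReal.ofReal p := by simpa using hp.le
  have hlip := abs_sub_le_of_deriv_bound hh hL
  have hL0 : 0 ≤ L := (abs_nonneg _).trans (hL 0)
  have hcu := hc.comp_aestronglyMeasurable hu1.1
  have hmeas : ∀ n, AEStronglyMeasurable (φ n) (wMeasure d a) :=
    fun n => (hφ n).1.continuous.aestronglyMeasurable
  -- A subsequence converging a.e. is needed so that h'(φ_k) → h'(u) pointwise.
  obtain ⟨ns, hns, hae⟩ :=
    (tendstoInMeasure_of_tendsto_eLpNorm hq0 hmeas hu1.1 hφu).exists_seq_tendsto_ae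
  have hφu' := hφu.comp hns.tendsto_atTop
  have hφG' := hφG.comp hns.tendsto_atTop
  refine ⟨hu1.of_le_mul (c := L) (hs.continuous.comp_aestronglyMeasurable hu1.1)
      (Eventually.of_forall fun x => by simpa [h0] using hlip (u x) 0),
    fun x => h' (u x) • G x, hG.comp hh hc hL,
    hGp.of_le_mul (c := L) (hcu.smul hGp.1) (Eventually.of_forall fun x => ?_),
    fun k x => h (φ (ns k) x), fun k => ⟨hs.comp (hφ _).1, (hφ _).2.comp_left h0⟩, ?_, ?_⟩
  · rw [norm_smul]; gcongr; exact hL _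
  · have hlim := ENNReal.Tendsto.const_mul (a := ENNReal.ofReal L) hφu'
      (Or.inr ENNReal.ofReal_ne_top)
    rw [mul_zero] at hlim
    refine tendsto_of_tendsto_of_tendsto_of_le_of_le tendsto_const_nhds hlim
      (fun _ => zero_le) fun k => ?_
    exact eLpNorm_le_mul_eLpNorm_of_ae_le_mul (Eventually.of_forall fun x => hlip _ _) _
  -- The gradient error is h'(φ_k)(∇φ_k - G) + (h'(φ_k) - h'(u)) G: the first term is at most L
  -- times the given error, the second is dominated by 2L|G|.
  · have hlim1 := ENNReal.Tendsto.const_mul (a := ENNReal.ofReal L) hφG'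
      (Or.inr ENNReal.ofReal_ne_top)
    rw [mul_zero] at hlim1
    have m2 : ∀ k, AEStronglyMeasurable (fun x => (h' (φ (ns k) x) - h' (u x)) • G x)
        (wMeasure d a) := fun k =>
      ((hc.comp_aestronglyMeasurable (hmeas _)).sub hcu).smul hGp.1
    have hlim2 : Tendsto (fun k => eLpNorm (fun x => (h' (φ (ns k) x) - h' (u x)) • G x)
        (ENNReal.ofReal p) (wMeasure d a)) atTop (𝓝 0) := by
      refine tendsto_eLpNorm_zero_of_dominated hq0 ENNReal.ofReal_ne_top m2
        (hGp.const_smul (2 * L)) (fun k x => ?_) ?_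
      · rw [enorm_le_iff_norm_le, Pi.smul_apply, norm_smul, norm_smul]
        gcongr
        rw [Real.norm_eq_abs, Real.norm_eq_abs, abs_of_nonneg (a := 2 * L) (by positivity)]
        linarith [abs_sub (h' (φ (ns k) x)) (h' (u x)), hL (φ (ns k) x), hL (u x)]
      · filter_upwards [hae] with x hx
        have := (((hc.tendsto (u x)).comp hx).sub_const (h' (u x))).smul_const (G x)
        simpa using this
    have hlim := hlim1.add hlim2
    rw [add_zero] at hlim
    refine tendsto_of_tendsto_of_tendsto_of_le_of_le tendsto_const_nhds hlim
      (fun _ => zero_le) fun k => ?_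
    have m1 : AEStronglyMeasurable
        (fun x => h' (φ (ns k) x) • (gradient (φ (ns k)) x - G x)) (wMeasure d a) :=
      (hc.comp_aestronglyMeasurable (hmeas _)).smul
        ((hφ _).continuous_gradient.aestronglyMeasurable.sub hGp.1)
    refine le_trans (le_of_eq ?_) ((eLpNorm_add_le m1 (m2 k) hq1).trans
      (add_le_add (eLpNorm_le_mul_eLpNorm_of_ae_le_mul (c := L)
        (Eventually.of_forall fun x => ?_) _) le_rfl))
    · congr 1
      funext x
      rw [gradient_comp hh ((hφ _).differentiable x), Pi.add_apply, smul_sub, sub_smul]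
      abel
    · rw [norm_smul]; gcongr; exact hL _

lemma MemW0.add {d : ℕ} {a p : ℝ} (hp : 1 < p) {u v : Pt d → ℝ} (hu : MemW0 a p u)
    (hv : MemW0 a p v) : MemW0 a p fun x => u x + v x := by
  obtain ⟨hu1, G, hG, hGp, φ, hφ, hφu, hφG⟩ := hu
  obtain ⟨hv1, H, hH, hHp, ψ, hψ, hψv, hψH⟩ := hv
  have hq1 : 1 ≤ ENNReal.ofReal p := by simpa using hp.le
  refine ⟨hu1.add hv1, _, hG.add hH, hGp.add hHp, fun n x => φ n x + ψ n x,
    fun n => ⟨(hφ n).1.add (hψ n).1, (hφ n).2.add (hψ n).2⟩, ?_, ?_⟩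
  · have hlim := hφu.add hψv
    rw [add_zero] at hlim
    refine tendsto_of_tendsto_of_tendsto_of_le_of_le tendsto_const_nhds hlim
      (fun _ => zero_le) fun n => le_trans (le_of_eq ?_) (eLpNorm_add_le
        ((hφ n).1.continuous.aestronglyMeasurable.sub hu1.1)
        ((hψ n).1.continuous.aestronglyMeasurable.sub hv1.1) hq1)
    congr 1
    funext x
    simp only [Pi.add_apply]
    ring
  · have hlim := hφG.add hψH
    rw [add_zero] at hlim
    refine tendsto_of_tendsto_of_tendsto_of_le_of_le tendsto_const_nhds hlim
      (fun _ => zero_le) fun n => le_trans (le_of_eq ?_) (eLpNorm_add_le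
        ((hφ n).continuous_gradient.aestronglyMeasurable.sub hGp.1)
        ((hψ n).continuous_gradient.aestronglyMeasurable.sub hHp.1) hq1)
    congr 1
    funext x
    simp only [Pi.add_apply]
    rw [gradient_add ((hφ n).differentiable x) ((hψ n).differentiable x)]
    abel

/-! ### Quasi-subadditivity of capacity and quasicontinuity -/

lemma hasDerivAt_sqrt_one_add_sq (t : ℝ) :
    HasDerivAt (fun t : ℝ => √(1 + t ^ 2)) (t / √(1 + t ^ 2)) t := by
  have h := ((hasDerivAt_pow 2 t).const_add 1).sqrt (by positivity)
  convert h using 1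
  field_simp
  simp [mul_comm]

lemma abs_div_sqrt_one_add_sq_lt (t : ℝ) : |t / √(1 + t ^ 2)| < 1 := by
  rw [abs_div, abs_of_nonneg (Real.sqrt_nonneg _), div_lt_one (by positivity)]
  exact Real.lt_sqrt_of_sq_lt (by rw [sq_abs]; linarith)

lemma continuous_div_sqrt_one_add_sq : Continuous fun t : ℝ => t / √(1 + t ^ 2) :=
  continuous_id.div (by fun_prop) fun t => by positivity

/-- A smooth Lipschitz function that is nonnegative, and at least `1` on `[1, ∞)`. -/
noncomputable def smoothCut (t : ℝ) : ℝ := 3 * (√(1 + t ^ 2) - 1)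

lemma contDiff_smoothCut : ContDiff ℝ ∞ smoothCut :=
  contDiff_const.mul (((contDiff_const.add (contDiff_id.pow 2)).sqrt
    fun t => by simp only [id]; positivity).sub contDiff_const)

lemma hasDerivAt_smoothCut (t : ℝ) : HasDerivAt smoothCut (3 * (t / √(1 + t ^ 2))) t :=
  ((hasDerivAt_sqrt_one_add_sq t).sub_const 1).const_mul 3

lemma abs_deriv_smoothCut_le (t : ℝ) : |3 * (t / √(1 + t ^ 2))| ≤ 3 := by
  rw [abs_mul, abs_of_nonneg (by norm_num : (0 : ℝ) ≤ 3)]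
  linarith [abs_div_sqrt_one_add_sq_lt t]

lemma smoothCut_nonneg (t : ℝ) : 0 ≤ smoothCut t := by
  have : 1 ≤ √(1 + t ^ 2) := Real.one_le_sqrt.2 (by linarith [sq_nonneg t])
  unfold smoothCut; linarith

lemma one_le_smoothCut {t : ℝ} (ht : 1 ≤ t) : 1 ≤ smoothCut t := by
  -- √2 ≥ 4/3, which is why the factor 3 in `smoothCut` is enough.
  have : 4 / 3 ≤ √(1 + t ^ 2) := Real.le_sqrt_of_sq_le (by nlinarith)
  unfold smoothCut; linarith

lemma ofReal_norm_add_rpow_le {E : Type*} [NormedAddCommGroup E] {p : ℝ} (hp : 0 ≤ p) {L : ℝ}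
    {x y x' y' : E} (hx : ‖x'‖ ≤ L * ‖x‖) (hy : ‖y'‖ ≤ L * ‖y‖) (hL : 0 ≤ L) :
    ENNReal.ofReal (‖x' + y'‖ ^ p) ≤ ENNReal.ofReal ((2 * L) ^ p) *
      (ENNReal.ofReal (‖x‖ ^ p) + ENNReal.ofReal (‖y‖ ^ p)) := by
  rw [← ENNReal.ofReal_add (by positivity) (by positivity), ← ENNReal.ofReal_mul (by positivity)]
  refine ENNReal.ofReal_le_ofReal ?_
  have h1 : ‖x' + y'‖ ≤ 2 * L * max ‖x‖ ‖y‖ := by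
    have hx' : L * ‖x‖ ≤ L * max ‖x‖ ‖y‖ := by gcongr; exact le_max_left _ _
    have hy' : L * ‖y‖ ≤ L * max ‖x‖ ‖y‖ := by gcongr; exact le_max_right _ _
    linarith [norm_add_le x' y']
  calc ‖x' + y'‖ ^ p ≤ (2 * L * max ‖x‖ ‖y‖) ^ p := by gcongr
    _ = (2 * L) ^ p * max ‖x‖ ‖y‖ ^ p := by rw [Real.mul_rpow (by positivity) (by positivity)]
    _ ≤ _ := by
      gcongr
      rcases max_cases ‖x‖ ‖y‖ with ⟨h, -⟩ | ⟨h, -⟩ <;> rw [h]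
      · linarith [Real.rpow_nonneg (norm_nonneg y) p]
      · linarith [Real.rpow_nonneg (norm_nonneg x) p]

lemma capacity_mono {d : ℕ} {a p : ℝ} {A B : Set (Pt d)} (h : A ⊆ B) :
    capacity a p A ≤ capacity a p B :=
  le_iInf₂ fun O hO => iInf₂_le O ⟨hO.1, h.trans hO.2⟩

/-- The capacity is quasi-subadditive. -/
lemma capacity_union_le {d : ℕ} {a p : ℝ} (hp : 1 < p) {A B : Set (Pt d)} {δ : ℝ≥0∞}
    (hA : capacity a p A < δ) (hB : capacity a p B < δ) :
    capacity a p (A ∪ B) ≤ ENNReal.ofReal ((2 * 3) ^ p) * (δ + δ) := by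
  simp only [capacity, iInf_lt_iff] at hA hB
  obtain ⟨O, ⟨hO, hAO⟩, u, ⟨hu, hu1⟩, heu⟩ := hA
  obtain ⟨Q, ⟨hQ, hBQ⟩, v, ⟨hv, hv1⟩, hev⟩ := hB
  have hc' : Continuous fun t : ℝ => 3 * (t / √(1 + t ^ 2)) :=
    continuous_const.mul continuous_div_sqrt_one_add_sq
  have h0 : smoothCut 0 = 0 := by simp [smoothCut]
  -- The sum replaces max(u, v): both summands are nonnegative everywhere, so neither spoils the
  -- bound supplied by the other.
  have hw := (hu.comp hp contDiff_smoothCut hasDerivAt_smoothCut hc' abs_deriv_smoothCut_le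
    h0).add hp (hv.comp hp contDiff_smoothCut hasDerivAt_smoothCut hc' abs_deriv_smoothCut_le h0)
  have hw1 : ∀ᵐ x ∂(volume : Measure (Pt d)), x ∈ O ∪ Q →
      1 ≤ smoothCut (u x) + smoothCut (v x) := by
    filter_upwards [hu1, hv1] with x hx hy
    rintro (h | h)
    · linarith [one_le_smoothCut (hx h), smoothCut_nonneg (v x)]
    · linarith [one_le_smoothCut (hy h), smoothCut_nonneg (u x)]
  refine (iInf₂_le (O ∪ Q) ⟨hO.union hQ, Set.union_subset_union hAO hBQ⟩).trans
    ((iInf₂_le (fun x => smoothCut (u x) + smoothCut (v x)) ⟨hw, hw1⟩).trans ?_)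
  · obtain ⟨-, G, hG, hGp, -⟩ := hu
    obtain ⟨-, H, hH, hHp, -⟩ := hv
    rw [((hG.comp hasDerivAt_smoothCut hc' abs_deriv_smoothCut_le).add
      (hH.comp hasDerivAt_smoothCut hc' abs_deriv_smoothCut_le)).energy_eq]
    rw [hG.energy_eq] at heu
    rw [hH.energy_eq] at hev
    refine (lintegral_mono fun x => ofReal_norm_add_rpow_le (by linarith) (L := 3) (x := G x)
      (y := H x) ?_ ?_ (by norm_num)).trans ?_
    · rw [norm_smul]; gcongr; exact abs_deriv_smoothCut_le _
    · rw [norm_smul]; gcongr; exact abs_deriv_smoothCut_le _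
    · rw [lintegral_const_mul' _ _ ENNReal.ofReal_ne_top, lintegral_add_left']
      · gcongr
      · exact (hGp.1.norm.aemeasurable.pow_const p).ennreal_ofReal

/-- The multiplicative constant in `capacity_union_le` is harmless, since C(δ + δ) → 0 as δ → 0. -/
lemma exists_capacity_union_lt {d : ℕ} {a p : ℝ} (hp : 1 < p) {ε : ℝ≥0∞} (hε : 0 < ε) :
    ∃ δ : ℝ≥0∞, 0 < δ ∧ ∀ A B : Set (Pt d), capacity a p A < δ → capacity a p B < δ →
      capacity a p (A ∪ B) < ε := by
  set C : ℝ≥0∞ := ENNReal.ofReal ((2 * 3) ^ p)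
  have hlim : Tendsto (fun δ : ℝ≥0∞ => C * (δ + δ)) (𝓝[>] 0) (𝓝 0) := by
    have h : Tendsto (fun δ : ℝ≥0∞ => C * (δ + δ)) (𝓝 0) (𝓝 (C * (0 + 0))) :=
      ENNReal.Tendsto.const_mul (tendsto_id.add tendsto_id) (Or.inr ENNReal.ofReal_ne_top)
    rw [add_zero, mul_zero] at h
    exact h.mono_left nhdsWithin_le_nhds
  obtain ⟨δ, h1, h2⟩ := ((hlim.eventually (gt_mem_nhds hε)).and self_mem_nhdsWithin).exists
  exact ⟨δ, h2, fun A B hA hB => (capacity_union_le hp hA hB).trans_lt h1⟩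

lemma capacity_union_eq_zero {d : ℕ} {a p : ℝ} (hp : 1 < p) {A B : Set (Pt d)}
    (hA : capacity a p A = 0) (hB : capacity a p B = 0) : capacity a p (A ∪ B) = 0 := by
  by_contra h
  obtain ⟨δ, hδ, H⟩ := exists_capacity_union_lt (d := d) (a := a) hp (pos_iff_ne_zero.2 h)
  exact (H A B (hA ▸ hδ) (hB ▸ hδ)).ne rfl

lemma QuasiContinuous.comp₂ {d : ℕ} {a p : ℝ} (hp : 1 < p) {v w : Pt d → ℝ}
    (hv : QuasiContinuous a p v) (hw : QuasiContinuous a p w) {Φ : ℝ × ℝ → ℝ}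
    (hΦ : Continuous Φ) : QuasiContinuous a p fun x => Φ (v x, w x) := by
  intro ε hε
  obtain ⟨δ, hδ, H⟩ := exists_capacity_union_lt (d := d) (a := a) hp hε
  obtain ⟨A, hAo, hA, hvA⟩ := hv δ hδ
  obtain ⟨B, hBo, hB, hwB⟩ := hw δ hδ
  refine ⟨A ∪ B, hAo.union hBo, H A B hA hB, hΦ.comp_continuousOn ?_⟩
  exact (hvA.mono (Set.compl_subset_compl.2 Set.subset_union_left)).prodMk
    (hwB.mono (Set.compl_subset_compl.2 Set.subset_union_right))

/-! ### Null sets and total mass of the weighted measure -/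

lemma ae_last_ne_zero (d : ℕ) : ∀ᵐ x ∂(volume : Measure (Pt d)), x (Fin.last d) ≠ 0 := by
  have h : (volume : Measure (Fin (d + 1) → ℝ)) {f | f (Fin.last d) = 0} = 0 :=
    Measure.pi_hyperplane _ _ _
  have := (PiLp.volume_preserving_ofLp (Fin (d + 1))).quasiMeasurePreserving.preimage_null h
  simpa [ae_iff] using this

lemma measurable_weight (d : ℕ) (a : ℝ) :
    Measurable fun x : Pt d => ENNReal.ofReal (|x (Fin.last d)| ^ a) :=
  ((EuclideanSpace.proj (𝕜 := ℝ) (Fin.last d)).continuous.abs.measurable.pow_const a).ennreal_ofReal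

lemma volume_ac_wMeasure (d : ℕ) (a : ℝ) : (volume : Measure (Pt d)) ≪ wMeasure d a := by
  refine withDensity_absolutelyContinuous' (measurable_weight d a).aemeasurable ?_
  filter_upwards [ae_last_ne_zero d] with x hx
  have := Real.rpow_pos_of_pos (abs_pos.2 hx) a
  simpa using this

/-- This is where N ≥ 2 enters: the slab is unbounded in some direction other than x_N. -/
lemma volume_slab {d : ℕ} (hd : d ≠ 0) :
    (volume : Measure (Pt d)) {x | x (Fin.last d) ∈ Set.Icc 1 2} = ⊤ := by
  have h : (volume : Measure (Fin (d + 1) → ℝ)) (Set.pi Set.univ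
      fun i => if i = Fin.last d then Set.Icc 1 2 else Set.univ) = ⊤ := by
    rw [volume_pi_pi, Fin.prod_univ_castSucc]
    simp [Fin.castSucc_ne_last, hd]
  rw [← (PiLp.volume_preserving_ofLp (Fin (d + 1))).measure_preimage] at h
  · convert h using 2
    ext x
    simp only [Set.mem_ofPred_eq, Set.mem_preimage, Set.mem_pi, Set.mem_univ, true_implies]
    refine ⟨fun hx i => ?_, fun hx => by simpa using hx (Fin.last d)⟩
    split_ifs with hi
    · rw [hi]; exact hx
    · trivial
  · refine (MeasurableSet.univ_pi fun i => ?_).nullMeasurableSet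
    split_ifs
    · exact measurableSet_Icc
    · exact MeasurableSet.univ

lemma wMeasure_univ {d : ℕ} (hd : d ≠ 0) (a : ℝ) : wMeasure d a Set.univ = ⊤ := by
  set S : Set (Pt d) := {x | x (Fin.last d) ∈ Set.Icc 1 2} with hS
  have hSm : MeasurableSet S :=
    (EuclideanSpace.proj (𝕜 := ℝ) (Fin.last d)).continuous.measurable measurableSet_Icc
  -- The minimum of t^a on [1, 2]: attained at 1 if a ≥ 0, at 2 if a ≤ 0.
  set κ : ℝ := min 1 (2 ^ a)
  have hκ : 0 < κ := lt_min one_pos (by positivity)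
  rw [← top_le_iff]
  calc ⊤ = ENNReal.ofReal κ * volume S := by
        rw [volume_slab hd, ENNReal.mul_top (by simpa using hκ)]
    _ = ∫⁻ _ in S, ENNReal.ofReal κ := by rw [setLIntegral_const]
    _ ≤ ∫⁻ x in S, ENNReal.ofReal (|x (Fin.last d)| ^ a) := by
        refine setLIntegral_mono (measurable_weight d a) fun x hx => ENNReal.ofReal_le_ofReal ?_
        obtain ⟨h1, h2⟩ := hx
        rw [abs_of_nonneg (by linarith)]
        rcases le_total 0 a with ha | ha
        · exact (min_le_left _ _).trans (Real.one_le_rpow h1 ha)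
        · exact (min_le_right _ _).trans
            (Real.rpow_le_rpow_of_nonpos (by linarith) h2 ha)
    _ = wMeasure d a S := (withDensity_apply _ hSm).symm
    _ ≤ _ := measure_mono (Set.subset_univ _)

/-! ### The C¹ positive part -/

lemma hasDerivAt_max_zero_sq (t : ℝ) : HasDerivAt (fun t : ℝ => max t 0 ^ 2) (2 * max t 0) t := by
  rcases lt_trichotomy t 0 with ht | rfl | ht
  · rw [max_eq_right ht.le, mul_zero]
    refine (hasDerivAt_const t (0 : ℝ)).congr_of_eventuallyEq ?_
    filter_upwards [gt_mem_nhds ht] with s hs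
    simp [max_eq_right (le_of_lt hs)]
  · rw [max_self, mul_zero, hasDerivAt_iff_tendsto_slope_zero]
    have h : Tendsto (fun t : ℝ => max t 0) (𝓝[≠] 0) (𝓝 0) := by
      have : Continuous fun t : ℝ => max t 0 := by fun_prop
      simpa using (this.tendsto 0).mono_left nhdsWithin_le_nhds
    refine h.congr' ?_
    filter_upwards [self_mem_nhdsWithin] with s hs
    have hs : s ≠ 0 := hs
    rcases le_total 0 s with h | h
    · simp only [zero_add, max_eq_left h, max_self, smul_eq_mul]; field_simp; simp
    · simp [max_eq_right h]
  · rw [max_eq_left ht.le]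
    have := hasDerivAt_pow 2 t
    simp only [Nat.cast_ofNat, Nat.add_one_sub_one, pow_one] at this
    refine this.congr_of_eventuallyEq ?_
    filter_upwards [lt_mem_nhds ht] with s hs
    simp [max_eq_left (le_of_lt hs)]

/-- A `C¹` substitute for the positive part, with slope in `(0, 1)` on `(0, ∞)`. -/
noncomputable def softPos (t : ℝ) : ℝ := √(1 + max t 0 ^ 2) - 1

/-- The derivative of `softPos`. -/
noncomputable def softPosDeriv (t : ℝ) : ℝ := max t 0 / √(1 + max t 0 ^ 2)

lemma hasDerivAt_softPos (t : ℝ) : HasDerivAt softPos (softPosDeriv t) t := by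
  have h := (((hasDerivAt_max_zero_sq t).const_add 1).sqrt (by positivity)).sub_const 1
  have e : softPosDeriv t = 2 * max t 0 / (2 * √(1 + max t 0 ^ 2)) :=
    (mul_div_mul_left _ _ two_ne_zero).symm
  rw [e]
  exact h

lemma continuous_softPos : Continuous softPos :=
  continuous_iff_continuousAt.2 fun t => (hasDerivAt_softPos t).continuousAt

lemma continuous_softPosDeriv : Continuous softPosDeriv :=
  continuous_div_sqrt_one_add_sq.comp (continuous_id.max continuous_const)

lemma softPosDeriv_nonneg (t : ℝ) : 0 ≤ softPosDeriv t := by unfold softPosDeriv; positivity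

lemma softPosDeriv_lt_one (t : ℝ) : softPosDeriv t < 1 :=
  (le_abs_self _).trans_lt (abs_div_sqrt_one_add_sq_lt (max t 0))

lemma abs_softPosDeriv_le (t : ℝ) : |softPosDeriv t| ≤ 1 :=
  (abs_div_sqrt_one_add_sq_lt (max t 0)).le

lemma softPos_of_nonpos {t : ℝ} (ht : t ≤ 0) : softPos t = 0 := by
  simp [softPos, max_eq_right ht]

lemma softPos_nonneg (t : ℝ) : 0 ≤ softPos t := by
  have : 1 ≤ √(1 + max t 0 ^ 2) := Real.one_le_sqrt.2 (by linarith [sq_nonneg (max t 0)])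
  unfold softPos; linarith

lemma softPos_pos {t : ℝ} (ht : 0 < t) : 0 < softPos t := by
  have : 1 < √(1 + max t 0 ^ 2) := by
    rw [max_eq_left ht.le, Real.lt_sqrt (by norm_num)]; nlinarith
  unfold softPos; linarith

lemma softPos_le (t : ℝ) : softPos t ≤ max t 0 := by
  have h0 : 0 ≤ max t 0 := le_max_right _ _
  have : √(1 + max t 0 ^ 2) ≤ 1 + max t 0 :=
    Real.sqrt_le_iff.2 ⟨by linarith, by nlinarith⟩
  unfold softPos; linarith

lemma abs_softPos_le (t : ℝ) : |softPos t| ≤ |t| := by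
  rw [abs_of_nonneg (softPos_nonneg t)]
  exact (softPos_le t).trans (max_le (le_abs_self t) (abs_nonneg t))

/-! ### Strict convexity and exchange of gradients -/

lemma norm_combo_rpow_le {E : Type*} [NormedAddCommGroup E] [NormedSpace ℝ E] {p θ : ℝ}
    (hp : 1 ≤ p) (h0 : 0 ≤ θ) (h1 : θ ≤ 1) (x y : E) :
    ‖(1 - θ) • x + θ • y‖ ^ p ≤ (1 - θ) * ‖x‖ ^ p + θ * ‖y‖ ^ p := by
  have h : ‖(1 - θ) • x + θ • y‖ ≤ (1 - θ) * ‖x‖ + θ * ‖y‖ := by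
    refine (norm_add_le _ _).trans_eq ?_
    rw [norm_smul, norm_smul, Real.norm_of_nonneg h0, Real.norm_of_nonneg (by linarith)]
  refine (Real.rpow_le_rpow (norm_nonneg _) h (by linarith)).trans ?_
  exact (convexOn_rpow hp).2 (norm_nonneg x) (norm_nonneg y) (by linarith) h0 (by ring)

/-- If the norms agree, strictness comes from the strictly convex norm of E; otherwise from strict
convexity of t ↦ t^p. -/
lemma norm_combo_rpow_lt {E : Type*} [NormedAddCommGroup E] [NormedSpace ℝ E]
    [StrictConvexSpace ℝ E] {p θ : ℝ} (hp : 1 < p) (h0 : 0 < θ) (h1 : θ < 1) {x y : E}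
    (hxy : x ≠ y) :
    ‖(1 - θ) • x + θ • y‖ ^ p < (1 - θ) * ‖x‖ ^ p + θ * ‖y‖ ^ p := by
  by_cases hn : ‖x‖ = ‖y‖
  · rw [← hn, ← add_mul, sub_add_cancel, one_mul]
    exact Real.rpow_lt_rpow (norm_nonneg _)
      (norm_combo_lt_of_ne le_rfl hn.ge hxy (by linarith) h0 (by ring)) (by linarith)
  · have h : ‖(1 - θ) • x + θ • y‖ ≤ (1 - θ) * ‖x‖ + θ * ‖y‖ := by
      refine (norm_add_le _ _).trans_eq ?_
      rw [norm_smul, norm_smul, Real.norm_of_nonneg h0.le, Real.norm_of_nonneg (by linarith)]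
    refine (Real.rpow_le_rpow (norm_nonneg _) h (by linarith)).trans_lt ?_
    exact (strictConvexOn_rpow hp).2 (norm_nonneg x) (norm_nonneg y) hn (by linarith) h0 (by ring)

/-- The two vectors are convex combinations of x and y with weights (1 - θ, θ) and (θ, 1 - θ), so
the weights add up to 1 on each side. -/
lemma norm_exchange_rpow_le {E : Type*} [NormedAddCommGroup E] [NormedSpace ℝ E] {p θ : ℝ}
    (hp : 1 ≤ p) (h0 : 0 ≤ θ) (h1 : θ ≤ 1) (x y : E) :
    ‖x - θ • (x - y)‖ ^ p + ‖y + θ • (x - y)‖ ^ p ≤ ‖x‖ ^ p + ‖y‖ ^ p := by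
  have e1 : x - θ • (x - y) = (1 - θ) • x + θ • y := by module
  have e2 : y + θ • (x - y) = (1 - θ) • y + θ • x := by module
  rw [e1, e2]
  linarith [norm_combo_rpow_le hp h0 h1 x y, norm_combo_rpow_le hp h0 h1 y x]

lemma norm_exchange_rpow_lt {E : Type*} [NormedAddCommGroup E] [NormedSpace ℝ E]
    [StrictConvexSpace ℝ E] {p θ : ℝ} (hp : 1 < p) (h0 : 0 < θ) (h1 : θ < 1) {x y : E}
    (hxy : x ≠ y) :
    ‖x - θ • (x - y)‖ ^ p + ‖y + θ • (x - y)‖ ^ p < ‖x‖ ^ p + ‖y‖ ^ p := by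
  have e1 : x - θ • (x - y) = (1 - θ) • x + θ • y := by module
  have e2 : y + θ • (x - y) = (1 - θ) • y + θ • x := by module
  rw [e1, e2]
  linarith [norm_combo_rpow_lt hp h0 h1 hxy, norm_combo_rpow_lt hp h0 h1 hxy.symm]

/-- Minimality of two functions against an exchange of a fraction `θ` of the difference of their
gradients forces that fraction of the difference to vanish. -/
lemma ae_smul_sub_eq_zero_of_energy_le {α E : Type*} [MeasurableSpace α] {μ : Measure α}
    [NormedAddCommGroup E] [NormedSpace ℝ E] [StrictConvexSpace ℝ E] {p : ℝ} (hp : 1 < p)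
    {G H : α → E} (hG : MemLp G (ENNReal.ofReal p) μ) (hH : MemLp H (ENNReal.ofReal p) μ)
    {θ : α → ℝ} (hθ : AEStronglyMeasurable θ μ) (h0 : ∀ x, 0 ≤ θ x) (h1 : ∀ x, θ x < 1)
    (hG' : ∫⁻ x, ENNReal.ofReal (‖G x‖ ^ p) ∂μ
      ≤ ∫⁻ x, ENNReal.ofReal (‖G x - θ x • (G x - H x)‖ ^ p) ∂μ)
    (hH' : ∫⁻ x, ENNReal.ofReal (‖H x‖ ^ p) ∂μ
      ≤ ∫⁻ x, ENNReal.ofReal (‖H x + θ x • (G x - H x)‖ ^ p) ∂μ) :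
    ∀ᵐ x ∂μ, θ x • (G x - H x) = 0 := by
  have hp0 : 0 ≤ p := by linarith
  have meas : ∀ {K : α → E}, AEStronglyMeasurable K μ →
      AEMeasurable (fun x => ENNReal.ofReal (‖K x‖ ^ p)) μ := fun hK =>
    (hK.norm.aemeasurable.pow_const p).ennreal_ofReal
  have fin : ∀ {K : α → E}, MemLp K (ENNReal.ofReal p) μ →
      ∫⁻ x, ENNReal.ofReal (‖K x‖ ^ p) ∂μ ≠ ⊤ := by
    intro K hK
    have := lintegral_rpow_enorm_lt_top_of_eLpNorm_lt_top (by simpa using by linarith)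
      ENNReal.ofReal_ne_top hK.2
    rw [ENNReal.toReal_ofReal hp0] at this
    refine ne_of_eq_of_ne (lintegral_congr fun x => ?_) this.ne
    rw [← ENNReal.ofReal_rpow_of_nonneg (norm_nonneg _) hp0, ofReal_norm]
  have m1 : AEStronglyMeasurable (fun x => G x - θ x • (G x - H x)) μ :=
    hG.1.sub (hθ.smul (hG.1.sub hH.1))
  have hle : (fun x => ENNReal.ofReal (‖G x - θ x • (G x - H x)‖ ^ p)
      + ENNReal.ofReal (‖H x + θ x • (G x - H x)‖ ^ p))
      ≤ᵐ[μ] fun x => ENNReal.ofReal (‖G x‖ ^ p) + ENNReal.ofReal (‖H x‖ ^ p) := by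
    refine Eventually.of_forall fun x => ?_
    simp only
    rw [← ENNReal.ofReal_add (by positivity) (by positivity),
      ← ENNReal.ofReal_add (by positivity) (by positivity)]
    exact ENNReal.ofReal_le_ofReal (norm_exchange_rpow_le hp.le (h0 x) (h1 x).le _ _)
  have hfin : ∫⁻ x, ENNReal.ofReal (‖G x‖ ^ p) + ENNReal.ofReal (‖H x‖ ^ p) ∂μ ≠ ⊤ := by
    rw [lintegral_add_left' (meas hG.1)]
    exact ENNReal.add_ne_top.2 ⟨fin hG, fin hH⟩
  -- A pointwise inequality whose finite integrals satisfy the reverse inequality is an a.e.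
  -- equality.
  have heq := ae_eq_of_ae_le_of_lintegral_le hle
    (ne_top_of_le_ne_top hfin (lintegral_mono_ae hle)) ((meas hG.1).add (meas hH.1)) (by
      rw [lintegral_add_left' (meas hG.1), lintegral_add_left' (meas m1)]
      exact add_le_add hG' hH')
  filter_upwards [heq] with x hx
  rw [← ENNReal.ofReal_add (by positivity) (by positivity),
    ← ENNReal.ofReal_add (by positivity) (by positivity),
    ENNReal.ofReal_eq_ofReal_iff (by positivity) (by positivity)] at hx
  rcases (h0 x).eq_or_lt with h | h
  · rw [← h, zero_smul]
  · by_cases hGH : G x = H x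
    · rw [hGH, sub_self, smul_zero]
    · exact absurd hx (norm_exchange_rpow_lt hp h (h1 x) hGH).ne

end CapPot

/-! ### Comparison of the potentials -/

open CapPot in
theorem proposition3p4 (d : ℕ) (hd : 2 ≤ d + 1) (a p : ℝ) (ha : -1 < a)
    (hp : max (1 + a) 1 < p) (hpN : p < ((d + 1 : ℕ) : ℝ) + a)
    (E F : Set (CapPot.Pt d)) (hEF : E ⊆ F)
    (uE uF : CapPot.Pt d → ℝ)
    (hE : CapPot.IsCapacitaryPotential a p E uE)
    (hF : CapPot.IsCapacitaryPotential a p F uF) :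
    ∀ᵐ x ∂(MeasureTheory.volume : MeasureTheory.Measure (CapPot.Pt d)), uE x ≤ uF x := by
  have hp1 : 1 < p := (le_max_right _ _).trans_lt hp
  obtain ⟨⟨⟨hE1, GE, hGE, hGEp⟩, vE, ⟨hvE, qE⟩, cE⟩, minE⟩ := hE
  obtain ⟨⟨⟨hF1, GF, hGF, hGFp⟩, vF, ⟨hvF, qF⟩, cF⟩, minF⟩ := hF
  have hm := (hE1.sub hF1).1
  have hGW := (hGE.sub hGF).comp hasDerivAt_softPos continuous_softPosDeriv abs_softPosDeriv_le
  have hθ := continuous_softPosDeriv.comp_aestronglyMeasurable hm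
  have hW : MemLp (fun x => softPos (uE x - uF x)) (ENNReal.ofReal (sobolevExp d a p))
      (wMeasure d a) :=
    (hE1.sub hF1).mono (continuous_softPos.comp_aestronglyMeasurable hm)
      (Filter.Eventually.of_forall fun x => abs_softPos_le _)
  have hGWp : MemLp (fun x => softPosDeriv (uE x - uF x) • (GE x - GF x)) (ENNReal.ofReal p)
      (wMeasure d a) := by
    refine (hGEp.sub hGFp).mono (hθ.smul (hGEp.sub hGFp).1)
      (Filter.Eventually.of_forall fun x => ?_)
    rw [norm_smul]
    exact mul_le_of_le_one_left (norm_nonneg _) (abs_softPosDeriv_le _)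
  have admE : Admissible a p E fun x => uE x - softPos (uE x - uF x) := by
    refine ⟨⟨hE1.sub hW, _, hGE.sub hGW, hGEp.sub hGWp⟩,
      fun x => vE x - softPos (vE x - vF x), ⟨?_, ?_⟩, ?_⟩
    · filter_upwards [hvE, hvF] with x h1 h2
      rw [h1, h2]
    · exact qE.comp₂ hp1 qF (Φ := fun z => z.1 - softPos (z.1 - z.2))
        (continuous_fst.sub (continuous_softPos.comp (continuous_fst.sub continuous_snd)))
    -- Off the two exceptional sets both vE and vF are ≥ 1 on E, and T(t) ≤ max(t, 0) gives vE -
    -- T(vE - vF) ≥ min(vE, vF).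
    · rw [← nonpos_iff_eq_zero, ← capacity_union_eq_zero hp1 cE cF]
      refine capacity_mono fun x ⟨hx, hx1⟩ => ?_
      by_contra hcon
      simp only [Set.mem_union, Set.mem_ofPred_eq, not_or, not_and, not_not] at hcon
      refine hx1 ?_
      beta_reduce
      have h1 := hcon.1 hx
      have h2 := hcon.2 (hEF hx)
      rcases le_total (vE x - vF x) 0 with h | h
      · rw [softPos_of_nonpos h]; linarith
      · have := softPos_le (vE x - vF x)
        rw [max_eq_left h] at this
        linarith
  have admF : Admissible a p F fun x => uF x + softPos (uE x - uF x) := by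
    refine ⟨⟨hF1.add hW, _, hGF.add hGW, hGFp.add hGWp⟩,
      fun x => vF x + softPos (vE x - vF x), ⟨?_, ?_⟩, ?_⟩
    · filter_upwards [hvE, hvF] with x h1 h2
      rw [h1, h2]
    · exact qE.comp₂ hp1 qF (Φ := fun z => z.2 + softPos (z.1 - z.2))
        (continuous_snd.add (continuous_softPos.comp (continuous_fst.sub continuous_snd)))
    · rw [← nonpos_iff_eq_zero, ← cF]
      refine capacity_mono fun x ⟨hx, hx1⟩ => ⟨hx, fun h => hx1 ?_⟩
      linarith [softPos_nonneg (vE x - vF x)]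
  have leE := minE _ admE
  have leF := minF _ admF
  rw [hGE.energy_eq, (hGE.sub hGW).energy_eq] at leE
  rw [hGF.energy_eq, (hGF.add hGW).energy_eq] at leF
  -- The exchange argument yields a μ-a.e. statement; it holds a.e. for Lebesgue measure because the
  -- weight vanishes at most on the null hyperplane x_N = 0.
  have hzero := (volume_ac_wMeasure d a).ae_le (ae_smul_sub_eq_zero_of_energy_le hp1 hGEp hGFp hθ
    (fun x => softPosDeriv_nonneg _) (fun x => softPosDeriv_lt_one _) leE leF)
  obtain ⟨c, hc⟩ := (hGW.congr_grad hzero).ae_const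
  have hexp : 0 < sobolevExp d a p :=
    div_pos (mul_pos (by linarith) (by linarith)) (by linarith)
  have hcW := (memLp_congr_ae ((wMeasure_ac d a).ae_le hc)).1 hW
  -- On a space of infinite measure, with 0 < p* < ∞, the only constant in L^{p*} is zero.
  rw [memLp_const_iff (by simpa using hexp) ENNReal.ofReal_ne_top,
    wMeasure_univ (by omega)] at hcW
  have hc0 : c = 0 := by simpa using hcW
  filter_upwards [hc] with x hx
  by_contra hlt
  have := softPos_pos (sub_pos.2 (not_le.1 hlt))
  rw [hx, hc0] at this
  exact lt_irrefl _ this
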